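/- Let $q$ be a prime power, let $\mathcal{R}=\mathbb{F}_q[x]$, and let $\mathcal{K}_\infty=\mathbb{F}_q((x^{-1}))$ with the absolute value normalized by $|x|=q$. Let $\mathcal{O}=\mathbb{F}_q[[x^{-1}]]=\{|a|\le 1\}$ and $\mathfrak{m}=x^{-1}\mathcal{O}$. Let $d\ge 2$, and let $m$ be the Haar measure on $\mathcal{K}_\infty^d$ with $m(\mathcal{O}^d)=1$. Let $\Lambda=g\mathcal{R}^d$ with $g\in\operatorname{GL}_d(\mathcal{K}_\infty)$ be a lattice, with fundamental domain $\mathcal{D}_\Lambda=g\mathfrak{m}^d$ and $\det(\Lambda)=|\det g|$. Let $\mathcal{C}=h\mathcal{O}^d$ with $h\in\operatorname{GL}_d(\mathcal{K}_\infty)$ be a convex body, and put $\|v\|_{\mathcal{C}}=\inf\{q^n : n\in\mathbb{Z},\ v\in x^n\mathcal{C}\}$ for $v\in\mathcal{K}_\infty^d$. Let $N\ge 0$ be an integer, and let $S\subseteq\mathcal{K}_\infty^d$ be a $(\Lambda,q^N)$-periodic lattice, that is, an $\mathbb{F}_q$-subspace with $\Lambda+S=S$ and $\#(\mathcal{D}_\Lambda\cap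 S)=q^N$. For $1\le i\le d$ let $$\lambda_{i,\mathcal{C}}(S)=\min\bigl\{r>0 : \dim_{\mathcal{K}_\infty}\operatorname{span}_{\mathcal{K}_\infty}\{s\in S : \|s\|_{\mathcal{C}}\le r\}\ge i\bigr\}.$$ Then these minima exist, and 1. $\displaystyle \lambda_{1,\mathcal{C}}(S)^d\le\frac{\det(\Lambda)}{q^N m(\mathcal{C})}$; 2. $\displaystyle \prod_{i=1}^d\lambda_{i,\mathcal{C}}(S)\le\frac{\det(\Lambda)}{q^N m(\mathcal{C})}$. -/

import Mathlib

open MeasureTheory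
open scoped Pointwise

namespace PeriodicLattice

/-- The field `𝔽_q((x⁻¹))`. The variable of the Laurent series is `x⁻¹`. -/
abbrev Kinf (F : Type*) [Field F] : Type _ := LaurentSeries F

/-- The element `x` of `𝔽_q((x⁻¹))`: it is the inverse of the variable of the Laurent series. -/
noncomputable def xvar (F : Type*) [Field F] : Kinf F := HahnSeries.single (-1 : ℤ) (1 : F)

/-- The absolute value on `𝔽_q((x⁻¹))`, with `|x| = q` and `|0| = 0`. -/
noncomputable def absInf {F : Type*} [Field F] [Fintype F] (a : Kinf F) : ℝ :=
  open Classical in if a = 0 then 0 else (Fintype.card F : ℝ) ^ (-a.order)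

/-- The unit ball `𝒪 = 𝔽_q[[x⁻¹]] = {a : |a| ≤ 1}`. -/
def ringO (F : Type*) [Field F] [Fintype F] : Set (Kinf F) := {a | absInf a ≤ 1}

/-- The maximal ideal `𝔪 = x⁻¹ 𝒪 = {a : |a| ≤ q⁻¹}`. -/
def idealM (F : Type*) [Field F] [Fintype F] : Set (Kinf F) :=
  {a | absInf a ≤ (Fintype.card F : ℝ)⁻¹}

/-- The ring `𝔽_q[x]` inside `𝔽_q((x⁻¹))`. -/
noncomputable def polyR (F : Type*) [Field F] : Set (Kinf F) :=
  Set.range (Polynomial.aeval (R := F) (xvar F))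

/-- The set `A^d` of vectors with all coordinates in `A`. -/
def cube {F : Type*} [Field F] (d : ℕ) (A : Set (Kinf F)) : Set (Fin d → Kinf F) :=
  {v | ∀ i, v i ∈ A}

/-- The image `g A` of a set of column vectors under `g ∈ GL_d`. -/
def glImage {F : Type*} [Field F] {d : ℕ} (g : GL (Fin d) (Kinf F)) (A : Set (Fin d → Kinf F)) :
    Set (Fin d → Kinf F) :=
  (fun v => (g : Matrix (Fin d) (Fin d) (Kinf F)).mulVec v) '' A

/-- The lattice `g 𝔽_q[x]^d`. -/
noncomputable def lattice {F : Type*} [Field F] {d : ℕ} (g : GL (Fin d) (Kinf F)) :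
    Set (Fin d → Kinf F) :=
  glImage g (cube d (polyR F))

/-- The fundamental domain `g 𝔪^d` of the lattice `g 𝔽_q[x]^d`. -/
def fundDomain {F : Type*} [Field F] [Fintype F] {d : ℕ} (g : GL (Fin d) (Kinf F)) :
    Set (Fin d → Kinf F) :=
  glImage g (cube d (idealM F))

/-- The determinant `|det g|` of the lattice `g 𝔽_q[x]^d`. -/
noncomputable def latticeDet {F : Type*} [Field F] [Fintype F] {d : ℕ}
    (g : GL (Fin d) (Kinf F)) : ℝ :=
  absInf (g : Matrix (Fin d) (Fin d) (Kinf F)).det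

/-- The convex body `h 𝒪^d`. -/
def convexBody {F : Type*} [Field F] [Fintype F] {d : ℕ} (h : GL (Fin d) (Kinf F)) :
    Set (Fin d → Kinf F) :=
  glImage h (cube d (ringO F))

/-- `S` is a `(Λ, q^N)`-periodic lattice, for `Λ = g 𝔽_q[x]^d`: an `𝔽_q`-subspace with `Λ + S = S`
which has exactly `q^N` points in the fundamental domain of `Λ`. -/
def IsPeriodicLattice {F : Type*} [Field F] [Fintype F] {d : ℕ} (g : GL (Fin d) (Kinf F)) (N : ℕ)
    (S : Submodule F (Fin d → Kinf F)) : Prop :=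
  lattice g + (S : Set (Fin d → Kinf F)) = (S : Set (Fin d → Kinf F)) ∧
    (fundDomain g ∩ (S : Set (Fin d → Kinf F))).ncard = Fintype.card F ^ N

/-- The norm `‖v‖_C`: the infimum of the radii `r = q^n`, `n ∈ ℤ`, with `v ∈ x^n C`.
It is attained for `v ≠ 0` if `C` is a convex body, and it is `0` for `v = 0`. -/
noncomputable def bodyNorm {F : Type*} [Field F] [Fintype F] {d : ℕ} (C : Set (Fin d → Kinf F))
    (v : Fin d → Kinf F) : ℝ :=
  sInf {r : ℝ | ∃ n : ℤ, r = (Fintype.card F : ℝ) ^ n ∧ v ∈ (xvar F ^ n) • C}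

/-- The radii `r > 0` for which the points of `S` of norm at most `r` span a space of dimension at
least `i`. -/
def succMinRadii {F : Type*} [Field F] [Fintype F] {d : ℕ} (C S : Set (Fin d → Kinf F)) (i : ℕ) :
    Set ℝ :=
  {r : ℝ | 0 < r ∧
    i ≤ Module.finrank (Kinf F) (Submodule.span (Kinf F) (S ∩ {v | bodyNorm C v ≤ r}))}

/-- The `i`-th successive minimum of `S` with respect to `C`, for `i = 1, …, d`. -/
noncomputable def succMin {F : Type*} [Field F] [Fintype F] {d : ℕ} (C S : Set (Fin d → Kinf F))
    (i : ℕ) : ℝ :=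
  sInf (succMinRadii C S i)

theorem absInf_le_one_iff {F : Type*} [Field F] [Fintype F] (a : Kinf F) :
    absInf a ≤ 1 ↔ Valued.v a ≤ (1 : WithZero (Multiplicative ℤ)) := by
  have hq : (1 : ℝ) < Fintype.card F := by exact_mod_cast Fintype.one_lt_card
  have key := LaurentSeries.valuation_le_iff_coeff_lt_eq_zero F (D := 0) (f := a)
  simp only [neg_zero, WithZero.exp_zero] at key
  rw [key]
  unfold absInf
  by_cases ha : a = 0
  · simp [ha]
  · rw [if_neg ha, zpow_le_one_iff_right₀ hq]
    constructor
    · intro h n hn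
      exact HahnSeries.coeff_eq_zero_of_lt_order (by omega)
    · intro h
      by_contra hc
      exact HahnSeries.coeff_order_eq_zero.not.mpr ha (h a.order (by omega))

theorem ringO_eq_range (F : Type*) [Field F] [Fintype F] :
    ringO F = Set.range (fun f : ℕ → F => ((PowerSeries.mk f : PowerSeries F) : LaurentSeries F)) := by
  ext a
  rw [ringO, Set.mem_ofPred_eq, absInf_le_one_iff, LaurentSeries.val_le_one_iff_eq_coe]
  constructor
  · rintro ⟨P, rfl⟩
    exact ⟨fun n => PowerSeries.coeff n P, congrArg _ (PowerSeries.ext fun n => PowerSeries.coeff_mk n _)⟩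
  · rintro ⟨f, rfl⟩
    exact ⟨_, rfl⟩

theorem isOpen_ringO (F : Type*) [Field F] [Fintype F] : IsOpen (ringO F) := by
  have : ringO F = (Valued.v : Valuation (Kinf F) (WithZero (Multiplicative ℤ))).integer := by
    ext a
    exact absInf_le_one_iff a
  rw [this]
  exact Valued.isOpen_integer _

theorem isCompact_ringO (F : Type*) [Field F] [Fintype F] : IsCompact (ringO F) := by
  let _ : TopologicalSpace F := ⊥
  have _ : DiscreteTopology F := ⟨rfl⟩
  rw [ringO_eq_range]
  refine isCompact_range (continuous_iff_continuousAt.mpr fun f => ?_)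
  intro U hU
  obtain ⟨γ, hU₁⟩ := Valued.mem_nhds.mp hU
  suffices hs : ∀ᶠ f' : ℕ → F in nhds f,
      Valued.v (((PowerSeries.mk f' : PowerSeries F) : LaurentSeries F) -
        ((PowerSeries.mk f : PowerSeries F) : LaurentSeries F)) <
        MonoidWithZeroHom.ValueGroup₀.embedding γ.1 by
    simp_rw [← Valued.v.restrict_lt_iff_lt_embedding] at hs
    exact Filter.mem_map.mpr (hs.mono fun _ hf => hU₁ hf)
  set D := -(WithZero.log (MonoidWithZeroHom.ValueGroup₀.embedding γ.1) - 1) with hD₀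
  have hD : WithZero.exp (-D) < MonoidWithZeroHom.ValueGroup₀.embedding γ.1 := by
    rw [← WithZero.lt_log_iff_exp_lt (by simp), hD₀]
    simp
  have hev : ∀ᶠ f' : ℕ → F in nhds f, ∀ n ∈ Finset.range D.toNat, f' n = f n := by
    rw [Filter.eventually_all_finset]
    intro n _
    have hc : Continuous fun f' : ℕ → F => f' n := continuous_apply n
    exact hc.continuousAt (IsOpen.mem_nhds (isOpen_discrete {f n}) rfl)
  refine hev.mono fun f' hf => lt_of_le_of_lt
    ((LaurentSeries.valuation_le_iff_coeff_lt_eq_zero F).mpr fun n hn => ?_) hD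
  rw [HahnSeries.coeff_sub, sub_eq_zero, PowerSeries.coeff_coe, PowerSeries.coeff_coe]
  split_ifs with h0
  · rfl
  · rw [PowerSeries.coeff_mk, PowerSeries.coeff_mk]
    exact hf _ (Finset.mem_range.mpr (by omega))

theorem isCompact_cube (F : Type*) [Field F] [Fintype F] (d : ℕ) :
    IsCompact (cube d (ringO F)) := by
  have : cube d (ringO F) = Set.univ.pi fun _ => ringO F := by ext v; simp [cube]
  rw [this]
  exact isCompact_univ_pi fun _ => isCompact_ringO F

theorem isOpen_cube (F : Type*) [Field F] [Fintype F] (d : ℕ) : IsOpen (cube d (ringO F)) := by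
  have : cube d (ringO F) = Set.univ.pi fun _ => ringO F := by ext v; simp [cube]
  rw [this]
  exact isOpen_set_pi Set.finite_univ fun _ _ => isOpen_ringO F

theorem zero_mem_cube (F : Type*) [Field F] [Fintype F] (d : ℕ) :
    (0 : Fin d → Kinf F) ∈ cube d (ringO F) := by
  intro i
  simp [ringO, absInf]

/-- The unit cube `𝒪^d` as a compact set with non-empty interior. -/
def unitCube (F : Type*) [Field F] [Fintype F] (d : ℕ) :
    TopologicalSpace.PositiveCompacts (Fin d → Kinf F) where
  carrier := cube d (ringO F)
  isCompact' := isCompact_cube F d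
  interior_nonempty' := by
    rw [(isOpen_cube F d).interior_eq]
    exact ⟨0, zero_mem_cube F d⟩

/-- The Haar measure `m` on the Borel sets of `𝔽_q((x⁻¹))^d`, normalized by `m(𝒪^d) = 1`. -/
noncomputable def haar (F : Type*) [Field F] [Fintype F] (d : ℕ) :
    @Measure (Fin d → Kinf F) (borel _) :=
  letI : MeasurableSpace (Fin d → Kinf F) := borel _
  haveI : BorelSpace (Fin d → Kinf F) := ⟨rfl⟩
  Measure.addHaarMeasure (unitCube F d)

end PeriodicLattice

/-! This is Minkowski's second theorem in an ultrametric setting, where one box gives the whole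
bound. Write λ_j = q^{n_j} and let V_j be the span of the points of S of norm less than λ_j, so that
dim V_j ≤ j - 1. A single e in GL_d(𝒪) makes the j-th coordinate vanish on e h⁻¹ V_j for every j
(`exists_mem_cubeStabilizer_flag`). Let B be the box |(e h⁻¹ v)_j| ≤ q^{n_j - 1}. If v ∈ B ∩ S and
the j-th coordinate of e h⁻¹ v is the largest, then v has norm less than λ_j, because e preserves
the maximum norm. Hence v ∈ V_j, the largest coordinate is zero, and v = 0.

As B is closed under subtraction, its translates by distinct points of S are disjoint, and a
pigeonhole argument modulo Λ gives q^N m(B) ≤ m(D_Λ) (`IsPeriodicLattice.card_pow_mul_haar_le`).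
Matrices scale m by |det| (`haarModulus_eq_absInf_det`), and B and D_Λ are both images of 𝔪^d, so
this is the second inequality; the first follows from λ_1 ≤ λ_i. The minima exist because the norm
is discrete, small balls meet S only in 0, and S contains Λ, hence a basis. -/

namespace PeriodicLattice

/-! ### The absolute value, and the decomposition of the field as 𝔽_q[x] ⊕ 𝔪. -/

section AbsoluteValue

variable {F : Type*} [Field F]

theorem xvar_ne_zero : xvar F ≠ 0 := by
  simp [xvar]

theorem xvar_zpow (n : ℤ) : xvar F ^ n = HahnSeries.single (-n) (1 : F) := by
  have hnat : ∀ k : ℕ, xvar F ^ k = HahnSeries.single (-(k : ℤ)) (1 : F) := by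
    intro k
    rw [xvar, HahnSeries.single_pow]
    simp
  obtain ⟨k, rfl | rfl⟩ := n.eq_nat_or_neg
  · rw [zpow_natCast, hnat]
  · rw [zpow_neg, zpow_natCast, hnat, inv_eq_iff_eq_inv, eq_comm]
    apply inv_eq_of_mul_eq_one_left
    simp

theorem coeff_aeval_xvar (p : Polynomial F) (k : ℤ) :
    (Polynomial.aeval (xvar F) p).coeff k = if k ≤ 0 then p.coeff (-k).toNat else 0 := by
  induction p using Polynomial.induction_on' with
  | add p q hp hq =>
    rw [map_add, HahnSeries.coeff_add, hp, hq]
    split_ifs <;> simp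
  | monomial n a =>
    have hC : algebraMap F (Kinf F) a = HahnSeries.single 0 a := by
      rw [HahnSeries.algebraMap_apply', PowerSeries.algebraMap_apply, Algebra.algebraMap_self_apply,
        HahnSeries.ofPowerSeries_C, HahnSeries.C_apply]
    rw [Polynomial.aeval_monomial, hC, ← zpow_natCast, xvar_zpow,
      HahnSeries.single_mul_single, HahnSeries.coeff_single, Polynomial.coeff_monomial]
    split_ifs <;> first | omega | simp

variable [Fintype F]

theorem one_lt_card_real : (1 : ℝ) < Fintype.card F := by
  exact_mod_cast Fintype.one_lt_card

theorem card_real_pos : (0 : ℝ) < Fintype.card F :=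
  zero_lt_one.trans one_lt_card_real

theorem absInf_zero : absInf (0 : Kinf F) = 0 := by
  simp [absInf]

theorem absInf_of_ne_zero {a : Kinf F} (ha : a ≠ 0) :
    absInf a = (Fintype.card F : ℝ) ^ (-a.order) := by
  simp [absInf, ha]

theorem absInf_pos {a : Kinf F} (ha : a ≠ 0) : 0 < absInf a := by
  rw [absInf_of_ne_zero ha]
  exact zpow_pos card_real_pos _

theorem absInf_nonneg (a : Kinf F) : 0 ≤ absInf a := by
  by_cases ha : a = 0
  · rw [ha, absInf_zero]
  · exact (absInf_pos ha).le

theorem absInf_eq_zero_iff {a : Kinf F} : absInf a = 0 ↔ a = 0 :=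
  ⟨fun h => by_contra fun ha => (absInf_pos ha).ne' h, fun h => h ▸ absInf_zero⟩

theorem absInf_one : absInf (1 : Kinf F) = 1 := by
  simp [absInf]

theorem absInf_mul (a b : Kinf F) : absInf (a * b) = absInf a * absInf b := by
  by_cases ha : a = 0
  · simp [ha, absInf_zero]
  by_cases hb : b = 0
  · simp [hb, absInf_zero]
  rw [absInf_of_ne_zero ha, absInf_of_ne_zero hb, absInf_of_ne_zero (mul_ne_zero ha hb),
    HahnSeries.order_mul ha hb, neg_add, zpow_add₀ card_real_pos.ne']

theorem absInf_neg (a : Kinf F) : absInf (-a) = absInf a := by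
  rw [← neg_one_mul, absInf_mul, absInf, if_neg (by simp)]
  simp [HahnSeries.order_neg]

variable (F) in
/-- The absolute value as a homomorphism of monoids with zero. -/
noncomputable def absHom : Kinf F →*₀ ℝ where
  toFun := absInf
  map_zero' := absInf_zero
  map_one' := absInf_one
  map_mul' := absInf_mul

theorem absHom_apply (a : Kinf F) : absHom F a = absInf a := rfl

theorem absInf_inv (a : Kinf F) : absInf a⁻¹ = (absInf a)⁻¹ :=
  map_inv₀ (absHom F) a

theorem absInf_xvar_zpow (n : ℤ) : absInf (xvar F ^ n) = (Fintype.card F : ℝ) ^ n := by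
  rw [absInf_of_ne_zero (zpow_ne_zero _ xvar_ne_zero), xvar_zpow,
    HahnSeries.order_single one_ne_zero, neg_neg]

theorem exists_absInf_eq_zpow {a : Kinf F} (ha : a ≠ 0) :
    ∃ n : ℤ, absInf a = (Fintype.card F : ℝ) ^ n :=
  ⟨_, absInf_of_ne_zero ha⟩

/-- Bounds become vanishing of coefficients, a linear condition; the ultrametric inequality is then
read off coefficientwise. -/
theorem absInf_le_zpow_iff {a : Kinf F} {n : ℤ} :
    absInf a ≤ (Fintype.card F : ℝ) ^ n ↔ ∀ k < -n, a.coeff k = 0 := by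
  by_cases ha : a = 0
  · simp [ha, absInf_zero, (zpow_pos card_real_pos n).le]
  rw [absInf_of_ne_zero ha, zpow_le_zpow_iff_right₀ one_lt_card_real]
  constructor
  · intro h k hk
    exact HahnSeries.coeff_eq_zero_of_lt_order (by omega)
  · intro h
    by_contra hc
    exact HahnSeries.coeff_order_eq_zero.not.mpr ha (h a.order (by omega))

theorem absInf_add_le_zpow {a b : Kinf F} {n : ℤ} (ha : absInf a ≤ (Fintype.card F : ℝ) ^ n)
    (hb : absInf b ≤ (Fintype.card F : ℝ) ^ n) : absInf (a + b) ≤ (Fintype.card F : ℝ) ^ n := by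
  rw [absInf_le_zpow_iff] at *
  intro k hk
  rw [HahnSeries.coeff_add, ha k hk, hb k hk, add_zero]

theorem absInf_add_le_max (a b : Kinf F) : absInf (a + b) ≤ max (absInf a) (absInf b) := by
  by_cases ha : a = 0
  · simp [ha]
  by_cases hb : b = 0
  · simp [hb]
  obtain ⟨n, hn⟩ := exists_absInf_eq_zpow ha
  obtain ⟨m, hm⟩ := exists_absInf_eq_zpow hb
  rcases le_total (absInf a) (absInf b) with h | h
  · rw [max_eq_right h, hm]
    exact absInf_add_le_zpow (h.trans_eq hm) hm.le
  · rw [max_eq_left h, hn]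
    exact absInf_add_le_zpow hn.le (h.trans_eq hn)

theorem absInf_add_le {a b : Kinf F} {r : ℝ} (ha : absInf a ≤ r) (hb : absInf b ≤ r) :
    absInf (a + b) ≤ r :=
  (absInf_add_le_max a b).trans (max_le ha hb)

theorem absInf_sub_le {a b : Kinf F} {r : ℝ} (ha : absInf a ≤ r) (hb : absInf b ≤ r) :
    absInf (a - b) ≤ r := by
  rw [sub_eq_add_neg]
  exact absInf_add_le ha ((absInf_neg b).trans_le hb)

theorem absInf_sum_le {ι : Type*} (s : Finset ι) (f : ι → Kinf F) {r : ℝ} (hr : 0 ≤ r)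
    (h : ∀ i ∈ s, absInf (f i) ≤ r) : absInf (∑ i ∈ s, f i) ≤ r := by
  classical
  induction s using Finset.induction_on with
  | empty => simpa [absInf_zero] using hr
  | insert i s hi ih =>
    rw [Finset.sum_insert hi]
    exact absInf_add_le (h _ (Finset.mem_insert_self _ _))
      (ih fun j hj => h j (Finset.mem_insert_of_mem hj))

theorem absInf_le_inv_card_iff {a : Kinf F} :
    absInf a ≤ (Fintype.card F : ℝ)⁻¹ ↔ ∀ k < 1, a.coeff k = 0 := by
  rw [← zpow_neg_one, absInf_le_zpow_iff, neg_neg]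

/-- Every element of `𝔽_q((x⁻¹))` is the sum of a polynomial and an element of `𝔪`. -/
theorem exists_polyR_add_idealM (a : Kinf F) : ∃ p ∈ polyR F, a + p ∈ idealM F := by
  -- `P` is minus the polynomial part of `a`; coefficients of index below `-|a.order|` vanish, so
  -- this range suffices.
  let P : Polynomial F :=
    ∑ n ∈ Finset.range (a.order.natAbs + 1), Polynomial.monomial n (-a.coeff (-(n : ℤ)))
  refine ⟨_, ⟨P, rfl⟩, ?_⟩
  change absInf _ ≤ _
  rw [absInf_le_inv_card_iff]
  intro k hk
  rw [HahnSeries.coeff_add, coeff_aeval_xvar, if_pos (by omega)]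
  simp only [P, Polynomial.finsetSum_coeff, Polynomial.coeff_monomial, Finset.sum_ite_eq',
    Finset.mem_range]
  rw [Int.toNat_of_nonneg (by omega)]
  split_ifs with h
  · simp
  · rw [HahnSeries.coeff_eq_zero_of_lt_order (by omega), add_zero]

/-- Polynomials live in indices ≤ 0 and 𝔪 in indices ≥ 1. -/
theorem eq_zero_of_mem_polyR_of_mem_idealM {a : Kinf F} (h₁ : a ∈ polyR F) (h₂ : a ∈ idealM F) :
    a = 0 := by
  obtain ⟨p, rfl⟩ := h₁
  have h₃ := absInf_le_inv_card_iff.mp h₂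
  have : p = 0 := by
    ext n
    have := h₃ (-(n : ℤ)) (by omega)
    rw [coeff_aeval_xvar, if_pos (by omega)] at this
    simpa using this
  rw [this, map_zero]

end AbsoluteValue

/-! ### Invertible matrices scale Haar measure by |det|. -/

section HaarModulus

variable {F : Type*} [Field F]

/-- The action of an invertible matrix on column vectors, as a homeomorphism of groups. -/
noncomputable def glEquiv {d : ℕ} (g : GL (Fin d) (Kinf F)) :
    (Fin d → Kinf F) ≃ₜ+ (Fin d → Kinf F) where
  toFun v := (g : Matrix (Fin d) (Fin d) (Kinf F)).mulVec v
  invFun v := ((g⁻¹ : GL (Fin d) (Kinf F)) : Matrix (Fin d) (Fin d) (Kinf F)).mulVec v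
  left_inv v := by simp [Matrix.mulVec_mulVec, ← Units.val_mul, -Matrix.coe_units_inv]
  right_inv v := by simp [Matrix.mulVec_mulVec, ← Units.val_mul, -Matrix.coe_units_inv]
  map_add' v w := Matrix.mulVec_add _ v w
  continuous_toFun := (Matrix.mulVecLin (g : Matrix (Fin d) (Fin d) (Kinf F))).continuous_on_pi
  continuous_invFun := (Matrix.mulVecLin
    ((g⁻¹ : GL (Fin d) (Kinf F)) : Matrix (Fin d) (Fin d) (Kinf F))).continuous_on_pi

theorem glEquiv_apply {d : ℕ} (g : GL (Fin d) (Kinf F)) (v : Fin d → Kinf F) :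
    glEquiv g v = (g : Matrix (Fin d) (Fin d) (Kinf F)).mulVec v := rfl

theorem glEquiv_mul_apply {d : ℕ} (g h : GL (Fin d) (Kinf F)) (v : Fin d → Kinf F) :
    glEquiv (g * h) v = glEquiv g (glEquiv h v) := by
  simp [glEquiv_apply, Matrix.mulVec_mulVec]

theorem glEquiv_inv_apply_self {d : ℕ} (g : GL (Fin d) (Kinf F)) (v : Fin d → Kinf F) :
    glEquiv g⁻¹ (glEquiv g v) = v := (glEquiv g).symm_apply_apply v

theorem glEquiv_apply_inv_self {d : ℕ} (g : GL (Fin d) (Kinf F)) (v : Fin d → Kinf F) :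
    glEquiv g (glEquiv g⁻¹ v) = v := (glEquiv g).apply_symm_apply v

theorem mem_glImage_iff {d : ℕ} {g : GL (Fin d) (Kinf F)} {A : Set (Fin d → Kinf F)}
    {v : Fin d → Kinf F} : v ∈ glImage g A ↔ glEquiv g⁻¹ v ∈ A := by
  constructor
  · rintro ⟨w, hw, rfl⟩
    change glEquiv g⁻¹ (glEquiv g w) ∈ A
    rwa [glEquiv_inv_apply_self]
  · intro h
    exact ⟨_, h, glEquiv_apply_inv_self g v⟩

theorem glImage_eq_preimage {d : ℕ} (g : GL (Fin d) (Kinf F)) (A : Set (Fin d → Kinf F)) :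
    glImage g A = glEquiv g⁻¹ ⁻¹' A := by
  ext v
  exact mem_glImage_iff

theorem isOpen_glImage {d : ℕ} (g : GL (Fin d) (Kinf F)) {A : Set (Fin d → Kinf F)}
    (hA : IsOpen A) : IsOpen (glImage g A) := by
  rw [glImage_eq_preimage]
  exact hA.preimage (glEquiv g⁻¹).continuous

/-- The diagonal matrix with given invertible entries. -/
noncomputable def glDiag (d : ℕ) : (Fin d → (Kinf F)ˣ) →* GL (Fin d) (Kinf F) :=
  (Units.map (Matrix.diagonalRingHom (Fin d) (Kinf F)).toMonoidHom).comp
    MulEquiv.piUnits.symm.toMonoidHom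

theorem coe_glDiag {d : ℕ} (t : Fin d → (Kinf F)ˣ) :
    (glDiag d t : Matrix (Fin d) (Fin d) (Kinf F)) = Matrix.diagonal fun i => (t i : Kinf F) :=
  rfl

theorem glEquiv_glDiag {d : ℕ} (t : Fin d → (Kinf F)ˣ) (v : Fin d → Kinf F) (i : Fin d) :
    glEquiv (glDiag d t) v i = t i * v i := by
  rw [glEquiv_apply, coe_glDiag, Matrix.mulVec_diagonal]

/-- An elementary transvection as an element of `GL_d`. -/
noncomputable def glTransvection {d : ℕ} {i j : Fin d} (hij : i ≠ j) (c : Kinf F) :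
    GL (Fin d) (Kinf F) where
  val := Matrix.transvection i j c
  inv := Matrix.transvection i j (-c)
  val_inv := by simp [Matrix.transvection_mul_transvection_same _ _ hij]
  inv_val := by simp [Matrix.transvection_mul_transvection_same _ _ hij]

theorem glEquiv_glTransvection {d : ℕ} {i j : Fin d} (hij : i ≠ j) (c : Kinf F)
    (v : Fin d → Kinf F) : glEquiv (glTransvection hij c) v = v + Pi.single i (c * v j) := by
  rw [glEquiv_apply]
  change (Matrix.transvection i j c).mulVec v = _
  rw [Matrix.transvection, Matrix.add_mulVec, Matrix.one_mulVec, Matrix.single_mulVec]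
  rfl

theorem inv_glTransvection {d : ℕ} {i j : Fin d} (hij : i ≠ j) (c : Kinf F) :
    (glTransvection hij c)⁻¹ = glTransvection hij (-c) := by
  ext1
  rfl

variable [Fintype F]

instance locallyCompactSpace_vec (d : ℕ) : LocallyCompactSpace (Fin d → Kinf F) :=
  (isCompact_cube F d).locallyCompactSpace_of_mem_nhds_of_addGroup
    ((isOpen_cube F d).mem_nhds (zero_mem_cube F d))

/-- The Borel sets of `𝔽_q((x⁻¹))^d`. -/
noncomputable local instance borelVec (d : ℕ) : MeasurableSpace (Fin d → Kinf F) := borel _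

local instance borelSpace_vec (d : ℕ) : BorelSpace (Fin d → Kinf F) := ⟨rfl⟩

instance isAddHaarMeasure_haar (d : ℕ) : (haar F d).IsAddHaarMeasure :=
  Measure.isAddHaarMeasure_addHaarMeasure _

instance regular_haar (d : ℕ) : (haar F d).Regular :=
  Measure.regular_addHaarMeasure

theorem haar_cube (d : ℕ) : haar F d (cube d (ringO F)) = 1 :=
  Measure.addHaarMeasure_self (K₀ := unitCube F d)

/-- The factor by which an invertible matrix scales the Haar measure. -/
noncomputable def haarModulus (d : ℕ) : GL (Fin d) (Kinf F) →* NNReal where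
  toFun g := addEquivAddHaarChar (glEquiv g)
  map_one' := by
    have : glEquiv (1 : GL (Fin d) (Kinf F)) = ContinuousAddEquiv.refl _ := by
      ext v i
      simp [glEquiv_apply]
    rw [this, addEquivAddHaarChar_refl]
  map_mul' g h := by
    have : glEquiv (g * h) = (glEquiv h).trans (glEquiv g) := by
      ext v : 1
      exact glEquiv_mul_apply g h v
    rw [this, addEquivAddHaarChar_trans, mul_comm]

theorem haar_glImage {d : ℕ} (g : GL (Fin d) (Kinf F)) (A : Set (Fin d → Kinf F)) :
    haar F d (glImage g A) = haarModulus d g * haar F d A := by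
  rw [glImage_eq_preimage, ← addEquivAddHaarChar_smul_preimage (haar F d) (X := A) (glEquiv g⁻¹)]
  change _ = haarModulus d g • (haarModulus d g⁻¹ • haar F d (glEquiv g⁻¹ ⁻¹' A))
  rw [smul_smul, ← map_mul, mul_inv_cancel, map_one, one_smul]

theorem haarModulus_eq {d : ℕ} (g : GL (Fin d) (Kinf F)) :
    (haarModulus d g : ENNReal) = haar F d (glImage g (cube d (ringO F))) := by
  rw [haar_glImage, haar_cube, mul_one]

theorem haarModulus_eq_one {d : ℕ} (g : GL (Fin d) (Kinf F))
    (h₁ : ∀ v ∈ cube d (ringO F), glEquiv g v ∈ cube d (ringO F))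
    (h₂ : ∀ v ∈ cube d (ringO F), glEquiv g⁻¹ v ∈ cube d (ringO F)) : haarModulus d g = 1 := by
  have : glImage g (cube d (ringO F)) = cube d (ringO F) := by
    ext v
    rw [mem_glImage_iff]
    refine ⟨fun h => ?_, h₂ v⟩
    rw [← glEquiv_apply_inv_self g v]
    exact h₁ _ h
  rw [← ENNReal.coe_inj, haarModulus_eq, this, haar_cube, ENNReal.coe_one]

/-- The element `x` as a unit. -/
noncomputable def xunit (F : Type*) [Field F] : (Kinf F)ˣ := Units.mk0 (xvar F) xvar_ne_zero

theorem absInf_xunit_zpow (n : ℤ) :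
    absInf ((xunit F ^ n : (Kinf F)ˣ) : Kinf F) = (Fintype.card F : ℝ) ^ n := by
  rw [Units.val_zpow_eq_zpow_val, xunit, Units.val_mk0, absInf_xvar_zpow]

theorem absInf_single_zero_le_one (c : F) :
    absInf (HahnSeries.single (0 : ℤ) c : Kinf F) ≤ 1 := by
  rw [← zpow_zero (Fintype.card F : ℝ), absInf_le_zpow_iff]
  intro k hk
  rw [HahnSeries.coeff_single_of_ne (by omega)]

theorem absInf_xvar : absInf (xvar F) = Fintype.card F := by
  simpa using absInf_xvar_zpow (F := F) 1

/-- The cube scaled by `x` in one coordinate is a disjoint union of `q` translates of the cube. -/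
theorem glImage_mulSingle_xunit {d : ℕ} (i : Fin d) :
    glImage (glDiag d (Pi.mulSingle i (xunit F))) (cube d (ringO F)) =
      ⋃ c : F, (fun v => Pi.single i (xvar F * HahnSeries.single (0 : ℤ) c) + v) ''
        cube d (ringO F) := by
  have hx : ∀ a : Kinf F, absInf a ≤ 1 → absInf (xvar F * a) ≤ (Fintype.card F : ℝ) ^ (1 : ℤ) := by
    intro a ha
    rw [absInf_mul, absInf_xvar, zpow_one]
    exact mul_le_of_le_one_right card_real_pos.le ha
  have hle : (1 : ℝ) ≤ (Fintype.card F : ℝ) ^ (1 : ℤ) := by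
    rw [zpow_one]
    exact one_lt_card_real.le
  ext v
  rw [mem_glImage_iff, Set.mem_iUnion, ← map_inv]
  have key : glEquiv (glDiag d (Pi.mulSingle i (xunit F))⁻¹) v ∈ cube d (ringO F) ↔
      ∀ j, absInf (v j) ≤ if j = i then (Fintype.card F : ℝ) ^ (1 : ℤ) else 1 := by
    refine forall_congr' fun j => ?_
    change absInf _ ≤ 1 ↔ _
    rw [glEquiv_glDiag, Pi.inv_apply, Units.val_inv_eq_inv_val, absInf_mul, absInf_inv]
    by_cases hj : j = i
    · subst hj
      rw [Pi.mulSingle_eq_same, if_pos rfl, xunit, Units.val_mk0, absInf_xvar,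
        inv_mul_le_iff₀ card_real_pos, zpow_one, mul_one]
    · rw [Pi.mulSingle_eq_of_ne hj, if_neg hj, Units.val_one, absInf_one, inv_one, one_mul]
  rw [key]
  constructor
  · intro h
    -- Index -1 holds the coefficient of x, the only one that keeps `v i` out of 𝒪.
    refine ⟨(v i).coeff (-1), v - Pi.single i (xvar F * HahnSeries.single (0 : ℤ)
      ((v i).coeff (-1))), fun j => ?_, add_sub_cancel _ _⟩
    change absInf _ ≤ 1
    have hj := h j
    by_cases hji : j = i
    · subst hji
      rw [if_pos rfl, absInf_le_zpow_iff] at hj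
      rw [Pi.sub_apply, Pi.single_eq_same, ← zpow_zero (Fintype.card F : ℝ), absInf_le_zpow_iff]
      intro k hk
      rw [HahnSeries.coeff_sub, xvar, HahnSeries.single_mul_single, HahnSeries.coeff_single]
      split_ifs with hk1
      · rw [hk1]
        simp
      · rw [hj k (by omega), sub_zero]
    · rw [if_neg hji] at hj
      rwa [Pi.sub_apply, Pi.single_eq_of_ne hji, sub_zero]
  · rintro ⟨c, w, hw, rfl⟩ j
    have hwj : absInf (w j) ≤ 1 := hw j
    change absInf ((Pi.single i (xvar F * HahnSeries.single (0 : ℤ) c) + w : Fin d → Kinf F) j) ≤ _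
    by_cases hji : j = i
    · subst hji
      rw [if_pos rfl, Pi.add_apply, Pi.single_eq_same]
      exact absInf_add_le (hx _ (absInf_single_zero_le_one c)) (hwj.trans hle)
    · rwa [if_neg hji, Pi.add_apply, Pi.single_eq_of_ne hji, zero_add]

theorem haarModulus_mulSingle_xunit {d : ℕ} (i : Fin d) :
    haarModulus d (glDiag d (Pi.mulSingle i (xunit F))) = Fintype.card F := by
  rw [← ENNReal.coe_inj, haarModulus_eq, glImage_mulSingle_xunit, measure_iUnion]
  · simp_rw [Set.image_add_left, measure_preimage_add, haar_cube]
    simp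
  · intro c c' hcc
    rw [Function.onFun, Set.disjoint_left]
    rintro _ ⟨v, hv, rfl⟩ ⟨w, hw, hvw⟩
    have hvi : absInf (v i) ≤ 1 := hv i
    have hwi : absInf (w i) ≤ 1 := hw i
    rw [← zpow_zero (Fintype.card F : ℝ), absInf_le_zpow_iff] at hvi hwi
    -- Elements of 𝒪 have no x-term, so the x-coefficient determines the translate.
    have := congrArg (fun u : Fin d → Kinf F => (u i).coeff (-1)) hvw
    simp only [Pi.add_apply, Pi.single_eq_same, HahnSeries.coeff_add, xvar,
      HahnSeries.single_mul_single, hvi (-1) (by omega), hwi (-1) (by omega)] at this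
    simp at this
    exact hcc this.symm
  · intro c
    rw [Set.image_add_left]
    exact ((isOpen_cube F d).preimage (continuous_const_add _)).measurableSet

theorem haarModulus_glDiag_eq_one {d : ℕ} (t : Fin d → (Kinf F)ˣ)
    (ht : ∀ i, absInf (t i : Kinf F) = 1) : haarModulus d (glDiag d t) = 1 := by
  apply haarModulus_eq_one
  · intro v hv i
    change absInf _ ≤ 1
    rw [glEquiv_glDiag, absInf_mul, ht, one_mul]
    exact hv i
  · intro v hv i
    change absInf _ ≤ 1
    rw [← map_inv, glEquiv_glDiag, Pi.inv_apply, Units.val_inv_eq_inv_val, absInf_mul, absInf_inv,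
      ht, inv_one, one_mul]
    exact hv i

/-- Split `u` into a power of x and a factor of absolute value 1, which preserves the cube. -/
theorem haarModulus_mulSingle {d : ℕ} (i : Fin d) (u : (Kinf F)ˣ) :
    (haarModulus d (glDiag d (Pi.mulSingle i u)) : ℝ) = absInf (u : Kinf F) := by
  obtain ⟨n, hn⟩ := exists_absInf_eq_zpow u.ne_zero
  have hu : u = (u * (xunit F ^ n)⁻¹) * xunit F ^ n := by group
  have h₁ : absInf ((u * (xunit F ^ n)⁻¹ : (Kinf F)ˣ) : Kinf F) = 1 := by
    rw [Units.val_mul, Units.val_inv_eq_inv_val, absInf_mul, absInf_inv, hn, absInf_xunit_zpow]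
    exact mul_inv_cancel₀ (zpow_pos card_real_pos n).ne'
  have h₂ : haarModulus d (glDiag d (Pi.mulSingle i (u * (xunit F ^ n)⁻¹))) = 1 := by
    apply haarModulus_glDiag_eq_one
    intro j
    by_cases hj : j = i
    · subst hj
      rwa [Pi.mulSingle_eq_same]
    · rw [Pi.mulSingle_eq_of_ne hj, Units.val_one, absInf_one]
  have h₃ : (Pi.mulSingle i (xunit F ^ n) : Fin d → (Kinf F)ˣ) =
      Pi.mulSingle i (xunit F) ^ n := by
    ext j
    by_cases hj : j = i
    · subst hj
      simp
    · simp [Pi.mulSingle_eq_of_ne hj]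
  conv_lhs => rw [hu]
  rw [Pi.mulSingle_mul, map_mul, map_mul, h₂, one_mul, hn, h₃, map_zpow, map_zpow,
    haarModulus_mulSingle_xunit]
  simp

theorem haarModulus_glDiag {d : ℕ} (t : Fin d → (Kinf F)ˣ) :
    (haarModulus d (glDiag d t) : ℝ) = ∏ i, absInf (t i : Kinf F) := by
  have key : ((NNReal.toRealHom : NNReal →* ℝ).comp (haarModulus d)).comp (glDiag d) =
      ((absHom F : Kinf F →* ℝ).comp (Units.coeHom (Kinf F))).comp
        (Finset.univ.prod fun i => Pi.evalMonoidHom (fun _ : Fin d => (Kinf F)ˣ) i) := by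
    -- Both sides are homomorphisms on a finite product of groups, so they need only agree on each
    -- factor.
    refine MonoidHom.functions_ext _ _ _ fun i u => ?_
    refine (haarModulus_mulSingle i u).trans ?_
    simp [MonoidHom.finsetProd_apply, absHom_apply]
  refine (DFunLike.congr_fun key t).trans ?_
  simp [MonoidHom.finsetProd_apply, map_prod, absHom_apply]

theorem glTransvection_mem_cube {d : ℕ} {i j : Fin d} (hij : i ≠ j) {c : Kinf F}
    (hc : absInf c ≤ 1) {v : Fin d → Kinf F} (hv : v ∈ cube d (ringO F)) :
    glEquiv (glTransvection hij c) v ∈ cube d (ringO F) := by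
  rw [glEquiv_glTransvection]
  intro k
  refine absInf_add_le (hv k) ?_
  by_cases hk : k = i
  · subst hk
    rw [Pi.single_eq_same, absInf_mul]
    exact mul_le_one₀ hc (absInf_nonneg _) (hv j)
  · rw [Pi.single_eq_of_ne hk, absInf_zero]
    exact zero_le_one

/-- Conjugation by a diagonal matrix scales `c` into 𝒪, where the transvection preserves the cube.
The modulus has commutative values, so conjugation does not change it. -/
theorem haarModulus_glTransvection {d : ℕ} {i j : Fin d} (hij : i ≠ j) (c : Kinf F) :
    haarModulus d (glTransvection hij c) = 1 := by
  obtain ⟨u, hu⟩ : ∃ u : (Kinf F)ˣ, absInf ((u : Kinf F) * c) ≤ 1 := by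
    by_cases hc : c = 0
    · exact ⟨1, by simp [hc, absInf_zero]⟩
    · exact ⟨(Units.mk0 c hc)⁻¹, by simp [hc, absInf_one]⟩
  have hconj : glTransvection hij c = (glDiag d (Pi.mulSingle i u))⁻¹ *
      (glTransvection hij ((u : Kinf F) * c) * glDiag d (Pi.mulSingle i u)) := by
    rw [eq_inv_mul_iff_mul_eq]
    apply Units.ext
    apply Matrix.mulVec_injective
    ext v : 1
    change glEquiv _ v = glEquiv _ v
    rw [glEquiv_mul_apply, glEquiv_mul_apply]
    ext k : 1
    rw [glEquiv_glDiag, glEquiv_glTransvection, glEquiv_glTransvection]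
    rw [Pi.add_apply, Pi.add_apply, glEquiv_glDiag, glEquiv_glDiag, Pi.mulSingle_eq_of_ne hij.symm]
    by_cases hk : k = i
    · subst hk
      simp only [Pi.single_eq_same, Pi.mulSingle_eq_same, Units.val_one]
      ring
    · simp [Pi.single_eq_of_ne hk, Pi.mulSingle_eq_of_ne hk]
  have h₁ : haarModulus d (glTransvection hij ((u : Kinf F) * c)) = 1 := by
    apply haarModulus_eq_one
    · intro v hv
      exact glTransvection_mem_cube hij hu hv
    · intro v hv
      rw [inv_glTransvection]
      exact glTransvection_mem_cube hij (by rwa [absInf_neg]) hv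
  rw [hconj, map_mul, map_mul, h₁, one_mul, ← map_mul, inv_mul_cancel, map_one]

/-- Gaussian elimination: both sides are multiplicative and agree on diagonal matrices and
transvections. -/
theorem haarModulus_eq_absInf_det {d : ℕ} (g : GL (Fin d) (Kinf F)) :
    (haarModulus d g : ℝ) = absInf (g : Matrix (Fin d) (Fin d) (Kinf F)).det := by
  have hdet : ∀ g : GL (Fin d) (Kinf F), (g : Matrix (Fin d) (Fin d) (Kinf F)).det ≠ 0 :=
    fun g => (Matrix.isUnits_det_units g).ne_zero
  suffices H : ∀ M : Matrix (Fin d) (Fin d) (Kinf F), M.det ≠ 0 →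
      ∀ g : GL (Fin d) (Kinf F), (g : Matrix (Fin d) (Fin d) (Kinf F)) = M →
        (haarModulus d g : ℝ) = absInf M.det from H _ (hdet g) g rfl
  intro M hM
  refine Matrix.diagonal_transvection_induction_of_det_ne_zero
    (fun M => ∀ g : GL (Fin d) (Kinf F), (g : Matrix (Fin d) (Fin d) (Kinf F)) = M →
      (haarModulus d g : ℝ) = absInf M.det) M hM ?_ ?_ ?_
  · intro D hD g hg
    rw [Matrix.det_diagonal] at hD ⊢
    have hD' : ∀ i, D i ≠ 0 := fun i => (Finset.prod_ne_zero_iff.mp hD) i (Finset.mem_univ i)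
    have : g = glDiag d fun i => Units.mk0 (D i) (hD' i) := by
      apply Units.ext
      rw [hg, coe_glDiag]
      rfl
    rw [this, haarModulus_glDiag]
    exact (map_prod (absHom F) _ _).symm
  · rintro ⟨i, j, hij, c⟩ g hg
    have : g = glTransvection hij c := Units.ext hg
    rw [this, haarModulus_glTransvection]
    change _ = absInf (Matrix.transvection i j c).det
    rw [Matrix.det_transvection_of_ne i j hij, absInf_one, NNReal.coe_one]
  · intro A B hA hB ihA ihB g hg
    have : g = Matrix.GeneralLinearGroup.mkOfDetNeZero A hA *
        Matrix.GeneralLinearGroup.mkOfDetNeZero B hB := Units.ext hg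
    rw [this, map_mul, NNReal.coe_mul, ihA _ rfl, ihB _ rfl, Matrix.det_mul, absInf_mul]

theorem toReal_haar_convexBody {d : ℕ} (h : GL (Fin d) (Kinf F)) :
    (haar F d (convexBody h)).toReal =
      absInf (h : Matrix (Fin d) (Fin d) (Kinf F)).det := by
  rw [convexBody, ← haarModulus_eq, ENNReal.coe_toReal, haarModulus_eq_absInf_det]

end HaarModulus

/-! ### GL_d(𝒪) as isometries of the maximum norm, and the triangularization of flags. -/

section Isometries

variable {F : Type*} [Field F] [Fintype F]

/-- The invertible matrices that preserve the unit cube, that is, `GL_d(𝒪)`. -/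
def cubeStabilizer (F : Type*) [Field F] [Fintype F] (d : ℕ) : Subgroup (GL (Fin d) (Kinf F)) where
  carrier := {g | ∀ v, glEquiv g v ∈ cube d (ringO F) ↔ v ∈ cube d (ringO F)}
  one_mem' v := by simp [glEquiv_apply]
  mul_mem' {g h} hg hh v := by rw [glEquiv_mul_apply, hg, hh]
  inv_mem' {g} hg v := by rw [← hg, glEquiv_apply_inv_self]

theorem mem_cubeStabilizer {d : ℕ} {g : GL (Fin d) (Kinf F)}
    (h₁ : ∀ v ∈ cube d (ringO F), glEquiv g v ∈ cube d (ringO F))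
    (h₂ : ∀ v ∈ cube d (ringO F), glEquiv g⁻¹ v ∈ cube d (ringO F)) :
    g ∈ cubeStabilizer F d := fun v =>
  ⟨fun h => glEquiv_inv_apply_self g v ▸ h₂ _ h, h₁ v⟩

theorem haarModulus_of_mem_cubeStabilizer {d : ℕ} {g : GL (Fin d) (Kinf F)}
    (hg : g ∈ cubeStabilizer F d) : haarModulus d g = 1 :=
  haarModulus_eq_one g (fun v hv => (hg v).mpr hv) fun v hv => ((inv_mem hg) v).mpr hv

theorem smul_mem_cube_iff {d : ℕ} (n : ℤ) (v : Fin d → Kinf F) :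
    xvar F ^ n • v ∈ cube d (ringO F) ↔ ∀ i, absInf (v i) ≤ (Fintype.card F : ℝ) ^ (-n) := by
  refine forall_congr' fun i => ?_
  change absInf (xvar F ^ n * v i) ≤ 1 ↔ _
  rw [absInf_mul, absInf_xvar_zpow, zpow_neg, ← one_div, le_div_iff₀ (zpow_pos card_real_pos n),
    mul_comm]

theorem absInf_glEquiv_le_iff {d : ℕ} {g : GL (Fin d) (Kinf F)} (hg : g ∈ cubeStabilizer F d)
    (v : Fin d → Kinf F) (n : ℤ) :
    (∀ i, absInf (glEquiv g v i) ≤ (Fintype.card F : ℝ) ^ n) ↔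
      ∀ i, absInf (v i) ≤ (Fintype.card F : ℝ) ^ n := by
  rw [← neg_neg n, ← smul_mem_cube_iff, ← smul_mem_cube_iff, ← hg (xvar F ^ (-n) • v),
    glEquiv_apply, glEquiv_apply, Matrix.mulVec_smul]

theorem exists_perm_mem_cubeStabilizer {d : ℕ} (σ : Equiv.Perm (Fin d)) :
    ∃ g ∈ cubeStabilizer F d, ∀ v, glEquiv g v = v ∘ σ := by
  let u : GL (Fin d) (Kinf F) :=
    ⟨σ.permMatrix (Kinf F), (σ⁻¹).permMatrix (Kinf F),
      by rw [← Matrix.permMatrix_mul, inv_mul_cancel, Matrix.permMatrix_one],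
      by rw [← Matrix.permMatrix_mul, mul_inv_cancel, Matrix.permMatrix_one]⟩
  have h₁ : ∀ v, glEquiv u v = v ∘ σ := fun _ => Matrix.permMatrix_mulVec _
  have h₂ : ∀ v, glEquiv u⁻¹ v = v ∘ (σ⁻¹ : Equiv.Perm (Fin d)) :=
    fun _ => Matrix.permMatrix_mulVec _
  refine ⟨u, mem_cubeStabilizer (fun v hv => ?_) (fun v hv => ?_), h₁⟩
  · rw [h₁]
    exact fun i => hv _
  · rw [h₂]
    exact fun i => hv _

theorem absInf_dotProduct_le_one {d : ℕ} {b v : Fin d → Kinf F} (hb : ∀ i, absInf (b i) ≤ 1)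
    (hv : v ∈ cube d (ringO F)) : absInf (b ⬝ᵥ v) ≤ 1 := by
  refine absInf_sum_le _ _ zero_le_one fun i _ => ?_
  rw [absInf_mul]
  exact mul_le_one₀ (hb i) (absInf_nonneg _) (hv i)

/-- The condition `b k = 0` makes the added matrix `N` square to zero, so `1 - N` is the inverse and
is integral as well. -/
theorem exists_shear_mem_cubeStabilizer {d : ℕ} (k : Fin d) {b : Fin d → Kinf F} (hbk : b k = 0)
    (hb : ∀ i, absInf (b i) ≤ 1) :
    ∃ g ∈ cubeStabilizer F d, ∀ v, glEquiv g v = v + Pi.single k (b ⬝ᵥ v) := by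
  let N : Matrix (Fin d) (Fin d) (Kinf F) := Matrix.vecMulVec (Pi.single k 1) b
  have hN : N * N = 0 := by
    simp [N, Matrix.vecMulVec_mul_vecMulVec, hbk]
  let u : GL (Fin d) (Kinf F) := ⟨1 + N, 1 - N,
    by rw [add_mul, one_mul, mul_sub, mul_one, hN]; abel,
    by rw [sub_mul, one_mul, mul_add, mul_one, hN]; abel⟩
  have hNv : ∀ v, N.mulVec v = Pi.single k (b ⬝ᵥ v) := by
    intro v
    ext i
    rw [Matrix.vecMulVec_mulVec]
    by_cases hi : i = k
    · subst hi; simp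
    · simp [Pi.single_eq_of_ne hi]
  have h₁ : ∀ v, glEquiv u v = v + Pi.single k (b ⬝ᵥ v) := by
    intro v
    change (1 + N).mulVec v = _
    rw [Matrix.add_mulVec, Matrix.one_mulVec, hNv]
  have h₂ : ∀ v, glEquiv u⁻¹ v = v - Pi.single k (b ⬝ᵥ v) := by
    intro v
    change (1 - N).mulVec v = _
    rw [Matrix.sub_mulVec, Matrix.one_mulVec, hNv]
  have h₃ : ∀ v ∈ cube d (ringO F), ∀ i, absInf ((Pi.single k (b ⬝ᵥ v) : Fin d → Kinf F) i) ≤ 1 := by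
    intro v hv i
    by_cases hi : i = k
    · subst hi
      rw [Pi.single_eq_same]
      exact absInf_dotProduct_le_one hb hv
    · rw [Pi.single_eq_of_ne hi, absInf_zero]
      exact zero_le_one
  refine ⟨u, mem_cubeStabilizer (fun v hv => ?_) (fun v hv => ?_), h₁⟩
  · rw [h₁]
    exact fun i => absInf_add_le (hv i) (h₃ v hv i)
  · rw [h₂]
    exact fun i => absInf_sub_le (hv i) (h₃ v hv i)

/-- A subspace of dimension at most `k` is annihilated by a linear form in the coordinates
`0, …, k` whose largest coefficient is `1`. -/
theorem exists_dotProduct_eq_zero {d : ℕ} (k : Fin d) (W : Submodule (Kinf F) (Fin d → Kinf F))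
    (hW : Module.finrank (Kinf F) W ≤ k) :
    ∃ (a : Fin d → Kinf F) (i₀ : Fin d), i₀ ≤ k ∧ a i₀ = 1 ∧ (∀ i, absInf (a i) ≤ 1) ∧
      ∀ w ∈ W, a ⬝ᵥ w = 0 := by
  let π : (Fin d → Kinf F) →ₗ[Kinf F] ({i : Fin d // i ≤ k} → Kinf F) :=
    LinearMap.funLeft (Kinf F) (Kinf F) Subtype.val
  have hcard : Fintype.card {i : Fin d // i ≤ k} = k + 1 := by
    rw [Fintype.card_of_subtype (Finset.Iic k) fun _ => Finset.mem_Iic, Fin.card_Iic]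
  -- The coordinates 0, …, k span dimension k + 1, which exceeds that of `W`, so some nonzero form
  -- kills the projection.
  have hlt : W.map π < ⊤ := by
    refine lt_top_iff_ne_top.mpr fun htop => ?_
    have h₁ := (Submodule.finrank_map_le π W).trans hW
    rw [htop, finrank_top, Module.finrank_fintype_fun_eq_card, hcard] at h₁
    omega
  obtain ⟨f, hf0, hf⟩ := Submodule.exists_le_ker_of_lt_top _ hlt
  let b : {i : Fin d // i ≤ k} → Kinf F := fun i => f (Pi.single i 1)
  have hfb : ∀ v, f v = ∑ i, b i * v i := by
    intro v
    conv_lhs => rw [pi_eq_sum_univ' v, map_sum]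
    refine Finset.sum_congr rfl fun i _ => ?_
    rw [map_smul, smul_eq_mul, mul_comm]
  have : Nonempty {i : Fin d // i ≤ k} := ⟨⟨k, le_rfl⟩⟩
  -- Dividing by a coefficient of maximal absolute value makes the form integral with one
  -- coefficient equal to 1.
  obtain ⟨i₀, hi₀⟩ := Finite.exists_max fun i => absInf (b i)
  have hb0 : b i₀ ≠ 0 := by
    intro h0
    apply hf0
    refine LinearMap.ext fun v => ?_
    rw [hfb]
    refine Finset.sum_eq_zero fun i _ => ?_
    have := hi₀ i
    rw [h0, absInf_zero] at this
    rw [absInf_eq_zero_iff.mp (le_antisymm this (absInf_nonneg _)), zero_mul]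
  refine ⟨fun i => if h : i ≤ k then b ⟨i, h⟩ / b i₀ else 0, i₀, i₀.2, ?_, fun i => ?_, ?_⟩
  · refine (dif_pos i₀.2).trans ?_
    exact div_self hb0
  · dsimp only
    split_ifs with h
    · rw [div_eq_mul_inv, absInf_mul, absInf_inv, ← div_eq_mul_inv]
      exact div_le_one_of_le₀ (hi₀ _) (absInf_nonneg _)
    · rw [absInf_zero]
      exact zero_le_one
  · intro w hw
    have h₁ : f (π w) = 0 := hf (Submodule.mem_map_of_mem hw)
    rw [hfb] at h₁
    have h₂ : ∑ i : {i : Fin d // i ≤ k}, b i / b i₀ * w i = 0 := by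
      calc ∑ i : {i : Fin d // i ≤ k}, b i / b i₀ * w i
          = (b i₀)⁻¹ * ∑ i, b i * π w i := by
            rw [Finset.mul_sum]
            refine Finset.sum_congr rfl fun i _ => ?_
            change b i / b i₀ * w i = (b i₀)⁻¹ * (b i * w i)
            ring
        _ = 0 := by rw [h₁, mul_zero]
    refine Eq.trans ?_ h₂
    rw [dotProduct, ← Finset.sum_subset (Finset.subset_univ (Finset.Iic k)),
      Finset.sum_subtype (Finset.Iic k) fun _ => Finset.mem_Iic]
    · refine Finset.sum_congr rfl fun i _ => ?_
      rw [dif_pos i.2]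
    · intro i _ hi
      rw [dif_neg (fun h => hi (Finset.mem_Iic.mpr h)), zero_mul]

/-- A swap moves the coefficient 1 of the annihilating form to position `k`, and a shear adds the
other terms to that coordinate, which thus becomes the form itself. Neither touches coordinates
beyond `k`, so the flag can be treated one step at a time. -/
theorem exists_mem_cubeStabilizer_apply_eq_zero {d : ℕ} (k : Fin d)
    (W : Submodule (Kinf F) (Fin d → Kinf F)) (hW : Module.finrank (Kinf F) W ≤ k) :
    ∃ g ∈ cubeStabilizer F d, (∀ v, ∀ i, k < i → glEquiv g v i = v i) ∧
      ∀ w ∈ W, glEquiv g w k = 0 := by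
  obtain ⟨a, i₀, hi₀, ha₁, ha, haW⟩ := exists_dotProduct_eq_zero k W hW
  let σ : Equiv.Perm (Fin d) := Equiv.swap i₀ k
  obtain ⟨p, hp, hpv⟩ := exists_perm_mem_cubeStabilizer (F := F) σ
  let b : Fin d → Kinf F := Function.update (a ∘ σ) k 0
  obtain ⟨s, hs, hsv⟩ := exists_shear_mem_cubeStabilizer k (b := b) (by simp [b]) (by
    intro i
    by_cases hi : i = k
    · subst hi
      simp [b, absInf_zero]
    · simpa [b, hi] using ha (σ i))
  refine ⟨s * p, mul_mem hs hp, fun v i hi => ?_, fun w hw => ?_⟩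
  · rw [glEquiv_mul_apply, hsv, hpv, Pi.add_apply, Pi.single_eq_of_ne hi.ne', add_zero,
      Function.comp_apply, Equiv.swap_apply_of_ne_of_ne (hi₀.trans_lt hi).ne' hi.ne']
  · have hsum : (a ∘ σ) ⬝ᵥ (w ∘ σ) = 0 := by
      exact (Equiv.sum_comp σ fun i => a i * w i).trans (haW w hw)
    have hσk : (a ∘ σ) k = 1 := by simp [σ, ha₁]
    have hb : b = a ∘ σ - Pi.single k 1 := by
      ext1 i
      by_cases hi : i = k
      · subst hi
        rw [Pi.sub_apply, hσk]
        simp [b]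
      · simp [b, hi]
    rw [glEquiv_mul_apply, hsv, hpv, Pi.add_apply, Pi.single_eq_same, hb, sub_dotProduct, hsum]
    simp

/-- A family of subspaces, the `j`-th of dimension at most `j`, can be moved by an element of
`GL_d(𝒪)` so that the `j`-th coordinate vanishes on the `j`-th subspace. -/
theorem exists_mem_cubeStabilizer_flag {d : ℕ} (V : Fin d → Submodule (Kinf F) (Fin d → Kinf F))
    (hV : ∀ j, Module.finrank (Kinf F) (V j) ≤ j) :
    ∃ g ∈ cubeStabilizer F d, ∀ j, ∀ v ∈ V j, glEquiv g v j = 0 := by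
  -- Work from the last coordinate down: the step at `k` fixes all later coordinates, so zeros
  -- already obtained survive.
  suffices H : ∀ m ≤ d, ∃ g ∈ cubeStabilizer F d, ∀ j : Fin d, d - m ≤ j →
      ∀ v ∈ V j, glEquiv g v j = 0 by
    obtain ⟨g, hg, h⟩ := H d le_rfl
    exact ⟨g, hg, fun j => h j (by omega)⟩
  intro m
  induction m with
  | zero => exact fun _ => ⟨1, one_mem _, fun j hj => by omega⟩
  | succ m ih =>
    intro hm
    obtain ⟨g, hg, h⟩ := ih (by omega)
    let k : Fin d := ⟨d - (m + 1), by omega⟩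
    let G : (Fin d → Kinf F) →ₗ[Kinf F] (Fin d → Kinf F) :=
      (g : Matrix (Fin d) (Fin d) (Kinf F)).mulVecLin
    obtain ⟨s, hs, hs₁, hs₂⟩ := exists_mem_cubeStabilizer_apply_eq_zero k ((V k).map G)
      ((Submodule.finrank_map_le G (V k)).trans (hV k))
    refine ⟨s * g, mul_mem hs hg, fun j hj v hv => ?_⟩
    rw [glEquiv_mul_apply]
    by_cases hjk : j = k
    · subst hjk
      exact hs₂ _ (Submodule.mem_map_of_mem hv)
    · have hkj : k < j := by
        refine lt_of_le_of_ne hj (Ne.symm hjk)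
      rw [hs₁ _ _ hkj]
      refine h j ?_ v hv
      have : d - (m + 1) < j := hkj
      omega

end Isometries

/-! ### Discreteness of the norm and existence of the minima. -/

section SuccessiveMinima

variable {F : Type*} [Field F] [Fintype F]

/-- The dilate `x^n h 𝒪^d` of the convex body `h 𝒪^d`. -/
def normBall {d : ℕ} (h : GL (Fin d) (Kinf F)) (n : ℤ) : Set (Fin d → Kinf F) :=
  {v | ∀ i, absInf (glEquiv h⁻¹ v i) ≤ (Fintype.card F : ℝ) ^ n}

theorem normBall_mono {d : ℕ} (h : GL (Fin d) (Kinf F)) : Monotone (normBall h) :=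
  fun _ _ hmn _ hv i => (hv i).trans (zpow_le_zpow_right₀ one_lt_card_real.le hmn)

theorem mem_smul_convexBody_iff {d : ℕ} (h : GL (Fin d) (Kinf F)) (n : ℤ) (v : Fin d → Kinf F) :
    v ∈ (xvar F ^ n) • convexBody h ↔ v ∈ normBall h n := by
  rw [Set.mem_smul_set_iff_inv_smul_mem₀ (zpow_ne_zero _ xvar_ne_zero), ← zpow_neg, convexBody,
    mem_glImage_iff, glEquiv_apply, Matrix.mulVec_smul, smul_mem_cube_iff, neg_neg]
  rfl

theorem eventually_mem_normBall {d : ℕ} (h : GL (Fin d) (Kinf F)) (v : Fin d → Kinf F) :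
    ∀ᶠ m : ℤ in Filter.atTop, v ∈ normBall h m := by
  refine Filter.eventually_all.mpr fun i => ?_
  by_cases hi : glEquiv h⁻¹ v i = 0
  · refine .of_forall fun m => ?_
    rw [hi, absInf_zero]
    exact (zpow_pos card_real_pos m).le
  · obtain ⟨k, hk⟩ := exists_absInf_eq_zpow hi
    filter_upwards [Filter.eventually_ge_atTop k] with m hm
    rw [hk]
    exact zpow_le_zpow_right₀ one_lt_card_real.le hm

/-- The candidate radii are powers of q, so `r` may be rounded down to one. -/
theorem bodyNorm_le_iff {d : ℕ} (h : GL (Fin d) (Kinf F)) (v : Fin d → Kinf F) {r : ℝ} {n : ℤ}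
    (h₁ : (Fintype.card F : ℝ) ^ n ≤ r) (h₂ : r < (Fintype.card F : ℝ) ^ (n + 1)) :
    bodyNorm (convexBody h) v ≤ r ↔ v ∈ normBall h n := by
  have hbdd : BddBelow {r : ℝ | ∃ n : ℤ, r = (Fintype.card F : ℝ) ^ n ∧
      v ∈ (xvar F ^ n) • convexBody h} :=
    ⟨0, by rintro _ ⟨n, rfl, -⟩; exact (zpow_pos card_real_pos n).le⟩
  have hne : {r : ℝ | ∃ n : ℤ, r = (Fintype.card F : ℝ) ^ n ∧
      v ∈ (xvar F ^ n) • convexBody h}.Nonempty := by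
    obtain ⟨m, hm⟩ := (eventually_mem_normBall h v).exists
    exact ⟨_, m, rfl, (mem_smul_convexBody_iff h m v).mpr hm⟩
  constructor
  · intro hv
    obtain ⟨_, ⟨k, rfl, hk⟩, hlt⟩ := exists_lt_of_csInf_lt hne (hv.trans_lt h₂)
    rw [zpow_lt_zpow_iff_right₀ one_lt_card_real] at hlt
    exact normBall_mono h (Int.lt_add_one_iff.mp hlt) ((mem_smul_convexBody_iff h k v).mp hk)
  · intro hv
    exact (csInf_le hbdd ⟨n, rfl, (mem_smul_convexBody_iff h n v).mpr hv⟩).trans h₁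

theorem eventually_notMem_normBall {d : ℕ} (h : GL (Fin d) (Kinf F)) {v : Fin d → Kinf F}
    (hv : v ≠ 0) : ∀ᶠ m : ℤ in Filter.atBot, v ∉ normBall h m := by
  obtain ⟨i, hi⟩ : ∃ i, glEquiv h⁻¹ v i ≠ 0 := by
    by_contra! hc
    apply hv
    rw [← glEquiv_apply_inv_self h v, funext hc]
    exact map_zero (glEquiv h)
  obtain ⟨k, hk⟩ := exists_absInf_eq_zpow hi
  filter_upwards [Filter.eventually_lt_atBot k] with m hm hmem
  have := hmem i
  rw [hk, zpow_le_zpow_iff_right₀ one_lt_card_real] at this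
  omega

/-- Small dilates of a convex body lie in the fundamental domain. -/
theorem eventually_normBall_subset {d : ℕ} (g h : GL (Fin d) (Kinf F)) :
    ∀ᶠ m : ℤ in Filter.atBot, normBall h m ⊆ fundDomain g := by
  let M : Matrix (Fin d) (Fin d) (Kinf F) := ((g⁻¹ * h : GL (Fin d) (Kinf F)) : Matrix _ _ _)
  obtain ⟨k, hk⟩ : ∃ k : ℤ, ∀ i j, absInf (M i j) ≤ (Fintype.card F : ℝ) ^ k := by
    have : ∀ᶠ k : ℤ in Filter.atTop, ∀ j i, absInf (M i j) ≤ (Fintype.card F : ℝ) ^ k := by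
      refine Filter.eventually_all.mpr fun j => ?_
      filter_upwards [eventually_mem_normBall (1 : GL (Fin d) (Kinf F)) (M.col j)] with k hk i
      simpa [glEquiv_apply] using hk i
    obtain ⟨k, hk⟩ := this.exists
    exact ⟨k, fun i j => hk j i⟩
  filter_upwards [Filter.eventually_le_atBot (-1 - k)] with m hm v hv
  rw [fundDomain, mem_glImage_iff]
  intro i
  have hMv : glEquiv g⁻¹ v = M.mulVec (glEquiv h⁻¹ v) := by
    change _ = glEquiv (g⁻¹ * h) _
    rw [glEquiv_mul_apply, glEquiv_apply_inv_self]
  change absInf _ ≤ _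
  rw [hMv, ← zpow_neg_one (Fintype.card F : ℝ)]
  change absInf (∑ j, M i j * glEquiv h⁻¹ v j) ≤ _
  refine absInf_sum_le _ _ ?_ fun j _ => ?_
  · exact (zpow_pos card_real_pos _).le
  rw [absInf_mul]
  calc absInf (M i j) * absInf (glEquiv h⁻¹ v j)
      ≤ (Fintype.card F : ℝ) ^ k * (Fintype.card F : ℝ) ^ m :=
        mul_le_mul (hk i j) (hv j) (absInf_nonneg _) (zpow_pos card_real_pos k).le
    _ = (Fintype.card F : ℝ) ^ (k + m) := (zpow_add₀ card_real_pos.ne' _ _).symm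
    _ ≤ (Fintype.card F : ℝ) ^ (-1 : ℤ) := zpow_le_zpow_right₀ one_lt_card_real.le (by omega)

/-- The dimension of the span of the points of `S` in `x^n h 𝒪^d`. -/
noncomputable def ballRank {d : ℕ} (h : GL (Fin d) (Kinf F)) (S : Set (Fin d → Kinf F)) (n : ℤ) :
    ℕ :=
  Module.finrank (Kinf F) (Submodule.span (Kinf F) (S ∩ normBall h n))

theorem ballRank_mono {d : ℕ} (h : GL (Fin d) (Kinf F)) (S : Set (Fin d → Kinf F)) :
    Monotone (ballRank h S) := fun _ _ hmn =>
  Submodule.finrank_mono (Submodule.span_mono (Set.inter_subset_inter_right _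
    (normBall_mono h hmn)))

theorem mem_succMinRadii_iff {d : ℕ} (h : GL (Fin d) (Kinf F)) (S : Set (Fin d → Kinf F)) (i : ℕ)
    {r : ℝ} {n : ℤ} (h₁ : (Fintype.card F : ℝ) ^ n ≤ r)
    (h₂ : r < (Fintype.card F : ℝ) ^ (n + 1)) :
    r ∈ succMinRadii (convexBody h) S i ↔ i ≤ ballRank h S n := by
  have : {v | bodyNorm (convexBody h) v ≤ r} = normBall h n :=
    Set.ext fun v => bodyNorm_le_iff h v h₁ h₂
  rw [succMinRadii, Set.mem_ofPred_eq, this, ballRank]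
  exact and_iff_right ((zpow_pos card_real_pos n).trans_le h₁)

/-- The exponent is the least integer at which the monotone rank reaches `i`. The deficit one step
earlier is kept for the volume bound. -/
theorem exists_isLeast_succMinRadii {d : ℕ} (h : GL (Fin d) (Kinf F)) (S : Set (Fin d → Kinf F))
    (i : ℕ) (htop : ∃ n, i ≤ ballRank h S n) (hbot : ∃ n, ballRank h S n < i) :
    ∃ n : ℤ, ballRank h S (n - 1) < i ∧
      IsLeast (succMinRadii (convexBody h) S i) ((Fintype.card F : ℝ) ^ n) := by
  obtain ⟨b, hb⟩ := hbot
  obtain ⟨n, hn, hmin⟩ := Int.exists_least_of_bdd (P := fun n => i ≤ ballRank h S n)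
    ⟨b, fun z hz => le_of_not_gt fun hzb =>
      absurd (hz.trans (ballRank_mono h S hzb.le)) (not_le.mpr hb)⟩ htop
  refine ⟨n, lt_of_not_ge fun hc => ?_, ?_, fun r hr => ?_⟩
  · have := hmin _ hc
    omega
  · rw [mem_succMinRadii_iff h S i le_rfl
      (zpow_lt_zpow_right₀ one_lt_card_real (Int.lt_succ n))]
    exact hn
  · obtain ⟨m, hm₁, hm₂⟩ := exists_mem_Ico_zpow hr.1 (one_lt_card_real (F := F))
    rw [mem_succMinRadii_iff h S i hm₁ hm₂] at hr
    exact (zpow_le_zpow_right₀ one_lt_card_real.le (hmin m hr)).trans hm₁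

theorem IsPeriodicLattice.lattice_subset {d : ℕ} {g : GL (Fin d) (Kinf F)} {N : ℕ}
    {S : Submodule F (Fin d → Kinf F)} (hS : IsPeriodicLattice g N S) :
    lattice g ⊆ (S : Set (Fin d → Kinf F)) := by
  intro v hv
  rw [← hS.1]
  exact ⟨v, hv, 0, S.zero_mem, add_zero v⟩

theorem IsPeriodicLattice.finite {d : ℕ} {g : GL (Fin d) (Kinf F)} {N : ℕ}
    {S : Submodule F (Fin d → Kinf F)} (hS : IsPeriodicLattice g N S) :
    (fundDomain g ∩ (S : Set (Fin d → Kinf F))).Finite := by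
  -- `ncard` is 0 on infinite sets, so the value q^N forces finiteness.
  refine Set.finite_of_ncard_ne_zero ?_
  rw [hS.2]
  exact pow_ne_zero _ Fintype.card_ne_zero

/-- Small balls lie in the fundamental domain, which has finitely many points of `S`; shrinking
further excludes the nonzero ones. -/
theorem IsPeriodicLattice.exists_ballRank_eq_zero {d : ℕ} {g : GL (Fin d) (Kinf F)} {N : ℕ}
    {S : Submodule F (Fin d → Kinf F)} (hS : IsPeriodicLattice g N S) (h : GL (Fin d) (Kinf F)) :
    ∃ n, ballRank h (S : Set (Fin d → Kinf F)) n = 0 := by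
  have h₁ : ∀ᶠ m : ℤ in Filter.atBot, ∀ v ∈ fundDomain g ∩ (S : Set (Fin d → Kinf F)),
      v ≠ 0 → v ∉ normBall h m := by
    rw [Filter.eventually_all_finite hS.finite]
    intro v _
    by_cases hv : v = 0
    · exact .of_forall fun m hm => absurd hv hm
    · filter_upwards [eventually_notMem_normBall h hv] with m hm _ using hm
  obtain ⟨m, hm₁, hm₂⟩ := (h₁.and (eventually_normBall_subset g h)).exists
  refine ⟨m, ?_⟩
  rw [ballRank, Submodule.finrank_eq_zero, Submodule.span_eq_bot]
  rintro v ⟨hvS, hvm⟩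
  by_contra hv
  exact hm₁ v ⟨hm₂ hvm, hvS⟩ hv hvm

/-- The columns of `g` lie in Λ ⊆ S and form a basis. -/
theorem IsPeriodicLattice.exists_ballRank_eq {d : ℕ} {g : GL (Fin d) (Kinf F)} {N : ℕ}
    {S : Submodule F (Fin d → Kinf F)} (hS : IsPeriodicLattice g N S) (h : GL (Fin d) (Kinf F)) :
    ∃ n, ballRank h (S : Set (Fin d → Kinf F)) n = d := by
  have h₁ : ∀ᶠ m : ℤ in Filter.atTop, ∀ j, glEquiv g (Pi.single j 1) ∈ normBall h m :=
    Filter.eventually_all.mpr fun j => eventually_mem_normBall h _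
  obtain ⟨m, hm⟩ := h₁.exists
  refine ⟨m, ?_⟩
  let G : (Fin d → Kinf F) →ₗ[Kinf F] (Fin d → Kinf F) :=
    (g : Matrix (Fin d) (Fin d) (Kinf F)).mulVecLin
  have hG : LinearMap.range G = ⊤ := LinearMap.range_eq_top.mpr (glEquiv g).surjective
  have htop : Submodule.span (Kinf F) ((S : Set (Fin d → Kinf F)) ∩ normBall h m) = ⊤ := by
    rw [eq_top_iff, ← hG, LinearMap.range_eq_map, ← (Pi.basisFun (Kinf F) (Fin d)).span_eq,
      Submodule.map_span, Submodule.span_le]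
    rintro _ ⟨_, ⟨j, rfl⟩, rfl⟩
    rw [Pi.basisFun_apply]
    refine Submodule.subset_span ⟨hS.lattice_subset ⟨_, fun i => ?_, rfl⟩, hm j⟩
    by_cases hi : i = j
    · subst hi
      rw [Pi.single_eq_same]
      exact ⟨1, map_one _⟩
    · rw [Pi.single_eq_of_ne hi]
      exact ⟨0, map_zero _⟩
  rw [ballRank, htop, finrank_top, Module.finrank_fin_fun]

end SuccessiveMinima

/-! ### Packing modulo Λ and the volume of the box. -/

section Volume

attribute [local instance] borelVec borelSpace_vec

/-- The group `g 𝔽_q[x]^d`. -/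
noncomputable def latticeSubgroup {F : Type*} [Field F] {d : ℕ} (g : GL (Fin d) (Kinf F)) :
    AddSubgroup (Fin d → Kinf F) where
  carrier := lattice g
  zero_mem' := by
    rw [lattice, mem_glImage_iff, map_zero]
    exact fun _ => ⟨0, map_zero _⟩
  add_mem' {v w} hv hw := by
    rw [lattice, mem_glImage_iff] at *
    rw [map_add]
    intro i
    obtain ⟨p, hp⟩ := hv i
    obtain ⟨r, hr⟩ := hw i
    exact ⟨p + r, by rw [map_add, hp, hr, Pi.add_apply]⟩
  neg_mem' {v} hv := by
    rw [lattice, mem_glImage_iff] at *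
    rw [map_neg]
    intro i
    obtain ⟨p, hp⟩ := hv i
    exact ⟨-p, by rw [map_neg, hp, Pi.neg_apply]⟩

variable {F : Type*} [Field F] [Fintype F]

theorem countable_lattice {d : ℕ} (g : GL (Fin d) (Kinf F)) : (lattice g).Countable := by
  have : Countable (Polynomial F) := Cardinal.mk_le_aleph0_iff.mp
    (Polynomial.cardinalMk_le_max.trans (max_le Cardinal.mk_le_aleph0 le_rfl))
  have h : (cube d (polyR F)).Countable := by
    have : cube d (polyR F) = Set.univ.pi fun _ => polyR F := by ext v; simp [cube]
    rw [this]
    exact Set.countable_univ_pi fun _ => Set.countable_range _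
  exact h.image _

theorem sub_mem_fundDomain {d : ℕ} {g : GL (Fin d) (Kinf F)} {v w : Fin d → Kinf F}
    (hv : v ∈ fundDomain g) (hw : w ∈ fundDomain g) : v - w ∈ fundDomain g := by
  rw [fundDomain, mem_glImage_iff] at *
  rw [map_sub]
  exact fun i => absInf_sub_le (hv i) (hw i)

theorem eq_zero_of_mem_lattice_of_mem_fundDomain {d : ℕ} {g : GL (Fin d) (Kinf F)}
    {v : Fin d → Kinf F} (h₁ : v ∈ lattice g) (h₂ : v ∈ fundDomain g) : v = 0 := by
  rw [lattice, mem_glImage_iff] at h₁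
  rw [fundDomain, mem_glImage_iff] at h₂
  have : glEquiv g⁻¹ v = 0 := funext fun i => eq_zero_of_mem_polyR_of_mem_idealM (h₁ i) (h₂ i)
  rw [← glEquiv_apply_inv_self g v, this, map_zero]

theorem exists_lattice_add_mem_fundDomain {d : ℕ} (g : GL (Fin d) (Kinf F))
    (v : Fin d → Kinf F) : ∃ l ∈ lattice g, l + v ∈ fundDomain g := by
  choose p hp hpv using fun i => exists_polyR_add_idealM (glEquiv g⁻¹ v i)
  refine ⟨glEquiv g p, ⟨p, hp, rfl⟩, ?_⟩
  rw [fundDomain, mem_glImage_iff, map_add, glEquiv_inv_apply_self, add_comm]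
  exact hpv

theorem isOpen_cube_idealM (d : ℕ) : IsOpen (cube d (idealM F)) := by
  have : cube d (idealM F) = (fun v => xvar F ^ (1 : ℤ) • v) ⁻¹' cube d (ringO F) := by
    ext v
    rw [Set.mem_preimage, smul_mem_cube_iff, zpow_neg_one]
    rfl
  rw [this]
  exact (isOpen_cube F d).preimage (continuous_const_smul _)

theorem haar_cube_idealM_ne_zero (d : ℕ) : haar F d (cube d (idealM F)) ≠ 0 := by
  refine (isOpen_cube_idealM d).measure_ne_zero _ ⟨0, fun i => ?_⟩
  change absInf (0 : Kinf F) ≤ _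
  rw [absInf_zero]
  exact inv_nonneg.mpr card_real_pos.le

theorem haar_cube_idealM_ne_top (d : ℕ) : haar F d (cube d (idealM F)) ≠ ⊤ := by
  refine ne_top_of_le_ne_top (haar_cube (F := F) d ▸ ENNReal.one_ne_top) (measure_mono ?_)
  exact fun v hv i => (hv i).trans (inv_le_one_of_one_le₀ one_lt_card_real.le)

theorem isAddFundamentalDomain_fundDomain {d : ℕ} (g : GL (Fin d) (Kinf F)) :
    IsAddFundamentalDomain (latticeSubgroup g) (fundDomain g) (haar F d) := by
  refine .mk' (isOpen_glImage g (isOpen_cube_idealM d)).measurableSet.nullMeasurableSet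
    fun v => ?_
  obtain ⟨l, hl, hlv⟩ := exists_lattice_add_mem_fundDomain g v
  refine ⟨⟨l, hl⟩, hlv, fun l' hl' => ?_⟩
  have h₁ : (l' : Fin d → Kinf F) - l ∈ lattice g := (latticeSubgroup g).sub_mem l'.2 hl
  have h₂ : (l' : Fin d → Kinf F) - l ∈ fundDomain g := by
    have := sub_mem_fundDomain hl' hlv
    rwa [AddSubgroup.vadd_def, vadd_eq_add, add_sub_add_right_eq_sub] at this
  exact Subtype.ext (sub_eq_zero.mp (eq_zero_of_mem_lattice_of_mem_fundDomain h₁ h₂))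

/-- An open set closed under subtraction that meets `S` only in `0` has volume at most the
covolume of `S`. -/
theorem IsPeriodicLattice.card_pow_mul_haar_le {d : ℕ} {g : GL (Fin d) (Kinf F)} {N : ℕ}
    {S : Submodule F (Fin d → Kinf F)} (hS : IsPeriodicLattice g N S) {B : Set (Fin d → Kinf F)}
    (hB : IsOpen B) (hsub : ∀ v ∈ B, ∀ w ∈ B, v - w ∈ B) (hBS : ∀ v ∈ B, v ∈ S → v = 0) :
    (Fintype.card F : ENNReal) ^ N * haar F d B ≤ haar F d (fundDomain g) := by
  let I := ↥(fundDomain g ∩ (S : Set (Fin d → Kinf F)))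
  have : Fintype I := hS.finite.fintype
  have hcard : Fintype.card I = Fintype.card F ^ N := by
    rw [← hS.2, ← Nat.card_coe_set_eq, Nat.card_eq_fintype_card]
  let T : Set (Fin d → Kinf F) := ⋃ t : I, (fun v => (t : Fin d → Kinf F) + v) '' B
  have hTm : ∀ t : I, MeasurableSet ((fun v => (t : Fin d → Kinf F) + v) '' B) := fun t => by
    rw [Set.image_add_left]
    exact (hB.preimage (continuous_const_add _)).measurableSet
  have hT : haar F d T = (Fintype.card F : ENNReal) ^ N * haar F d B := by
    rw [measure_iUnion _ hTm]
    · simp_rw [Set.image_add_left, measure_preimage_add]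
      rw [tsum_fintype, Finset.sum_const, Finset.card_univ, hcard, nsmul_eq_mul, Nat.cast_pow]
    · intro t t' htt
      rw [Function.onFun, Set.disjoint_left]
      rintro _ ⟨v, hv, rfl⟩ ⟨w, hw, hvw⟩
      have h₁ : v - w = (t' : Fin d → Kinf F) - t := by
        linear_combination (exp := 1) -hvw
      have h₂ := hBS _ (hsub v hv w hw) (h₁ ▸ S.sub_mem t'.2.2 t.2.2)
      rw [h₁, sub_eq_zero] at h₂
      exact htt (Subtype.ext h₂.symm)
  rw [← hT]
  -- Blichfeldt's pigeonhole: a set of volume larger than the fundamental domain meets another of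
  -- its Λ-translates.
  by_contra! hlt
  have : Countable (latticeSubgroup g) := (countable_lattice g).to_subtype
  obtain ⟨l, l', hll, hdisj⟩ := exists_pair_mem_lattice_not_disjoint_vadd
    (isAddFundamentalDomain_fundDomain g) (MeasurableSet.iUnion hTm).nullMeasurableSet hlt
  obtain ⟨_, ⟨_, ha, rfl⟩, _, hb, hab⟩ := Set.not_disjoint_iff.mp hdisj
  obtain ⟨t, v, hv, rfl⟩ := Set.mem_iUnion.mp ha
  obtain ⟨t', w, hw, rfl⟩ := Set.mem_iUnion.mp hb
  have hab' : (l' : Fin d → Kinf F) + (t' + w) = l + (t + v) := hab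
  have h₁ : v - w = ((l' : Fin d → Kinf F) - l) + (t' - t) := by
    linear_combination (exp := 1) -hab'
  have hL : (l' : Fin d → Kinf F) - l ∈ lattice g := (latticeSubgroup g).sub_mem l'.2 l.2
  have h₂ := hBS _ (hsub v hv w hw)
    (h₁ ▸ S.add_mem (hS.lattice_subset hL) (S.sub_mem t'.2.2 t.2.2))
  -- This difference lies both in Λ and, as the domain is closed under subtraction, in the
  -- fundamental domain; so it is zero.
  have h₃ : (l' : Fin d → Kinf F) - l = t - t' := by
    linear_combination (exp := 1) h₂ - h₁
  have h₄ := eq_zero_of_mem_lattice_of_mem_fundDomain hL (h₃ ▸ sub_mem_fundDomain t.2.1 t'.2.1)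
  exact hll (Subtype.ext (sub_eq_zero.mp h₄).symm)

/-- Only the rank deficit just below each radius matters; the exponents need not be monotone. -/
theorem IsPeriodicLattice.prod_zpow_mul_le {d : ℕ} {g : GL (Fin d) (Kinf F)} {N : ℕ}
    {S : Submodule F (Fin d → Kinf F)} (hS : IsPeriodicLattice g N S) (h : GL (Fin d) (Kinf F))
    (n : Fin d → ℤ) (hn : ∀ j, ballRank h (S : Set (Fin d → Kinf F)) (n j - 1) < j + 1) :
    (∏ j, (Fintype.card F : ℝ) ^ n j) *
      ((Fintype.card F : ℝ) ^ N * (haar F d (convexBody h)).toReal) ≤ latticeDet g := by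
  obtain ⟨e, he, heV⟩ := exists_mem_cubeStabilizer_flag
    (fun j => (Submodule.span (Kinf F) ((S : Set (Fin d → Kinf F)) ∩ normBall h (n j - 1))).map
      ((h⁻¹ : GL (Fin d) (Kinf F)) : Matrix (Fin d) (Fin d) (Kinf F)).mulVecLin)
    fun j => (Submodule.finrank_map_le _ _).trans (Nat.lt_succ_iff.mp (hn j))
  let t : Fin d → (Kinf F)ˣ := fun j => xunit F ^ n j
  -- The box is `u` 𝔪^d: 𝔪 in place of 𝒪 supplies the strict radius q^{n_j - 1} and matches the
  -- shape of the fundamental domain.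
  let u : GL (Fin d) (Kinf F) := h * (e⁻¹ * glDiag d t)
  have hmem : ∀ v, v ∈ glImage u (cube d (idealM F)) ↔
      ∀ j, absInf (glEquiv e (glEquiv h⁻¹ v) j) ≤ (Fintype.card F : ℝ) ^ (n j - 1) := by
    intro v
    rw [mem_glImage_iff, mul_inv_rev, mul_inv_rev, inv_inv, glEquiv_mul_apply, glEquiv_mul_apply,
      ← map_inv]
    refine forall_congr' fun j => ?_
    change absInf _ ≤ _ ↔ _
    rw [glEquiv_glDiag, Pi.inv_apply, Units.val_inv_eq_inv_val, absInf_mul, absInf_inv,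
      absInf_xunit_zpow, inv_mul_le_iff₀ (zpow_pos card_real_pos _),
      ← zpow_neg_one (Fintype.card F : ℝ),
      ← zpow_add₀ card_real_pos.ne', sub_eq_add_neg]
  have hle : (Fintype.card F : ENNReal) ^ N * haar F d (glImage u (cube d (idealM F))) ≤
      haar F d (fundDomain g) := by
    refine hS.card_pow_mul_haar_le (isOpen_glImage u (isOpen_cube_idealM d)) ?_ ?_
    · intro v hv w hw
      rw [hmem] at *
      intro j
      rw [map_sub, map_sub]
      exact absInf_sub_le (hv j) (hw j)
    · intro v hv hvS
      rw [hmem] at hv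
      set w := glEquiv e (glEquiv h⁻¹ v) with hw
      suffices hw0 : w = 0 by
        rw [← glEquiv_apply_inv_self h v, ← glEquiv_inv_apply_self e (glEquiv h⁻¹ v), ← hw, hw0,
          map_zero, map_zero]
      by_contra hw0
      obtain ⟨j₀, hj₀⟩ := Function.ne_iff.mp hw0
      have : Nonempty (Fin d) := ⟨j₀⟩
      -- At the largest coordinate the box bound controls all coordinates, so `v` lies in the ball
      -- defining the j-th subspace.
      obtain ⟨j, hj⟩ := Finite.exists_max fun j => absInf (w j)
      refine (absInf_pos hj₀).not_ge ((hj j₀).trans_eq ?_)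
      rw [absInf_eq_zero_iff]
      refine heV j _ (Submodule.mem_map_of_mem (Submodule.subset_span ⟨hvS, ?_⟩))
      exact (absInf_glEquiv_le_iff he _ _).mp fun i => (hj i).trans (hv j)
  -- The volume of 𝔪^d is a common factor, finite and nonzero.
  rw [fundDomain, haar_glImage, haar_glImage, ← mul_assoc,
    ENNReal.mul_le_mul_iff_left (haar_cube_idealM_ne_zero d) (haar_cube_idealM_ne_top d)] at hle
  have hle' : (Fintype.card F : NNReal) ^ N * haarModulus d u ≤ haarModulus d g := by
    exact_mod_cast hle
  rw [map_mul, map_mul, haarModulus_of_mem_cubeStabilizer (inv_mem he), one_mul] at hle'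
  have hle'' : (Fintype.card F : ℝ) ^ N * (haarModulus d h * haarModulus d (glDiag d t)) ≤
      haarModulus d g := by
    exact_mod_cast hle'
  rw [haarModulus_glDiag, haarModulus_eq_absInf_det, haarModulus_eq_absInf_det] at hle''
  simp_rw [t, absInf_xunit_zpow] at hle''
  rw [toReal_haar_convexBody]
  refine le_of_eq_of_le ?_ hle''
  ring

end Volume

end PeriodicLattice

/-! ### The theorem. -/

open PeriodicLattice in
theorem mainTheorem2 {F : Type*} [Field F] [Fintype F] (d : ℕ) (hd : 2 ≤ d)
    (g h : GL (Fin d) (Kinf F)) (N : ℕ) (S : Submodule F (Fin d → Kinf F))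
    (hS : IsPeriodicLattice g N S) :
    (∀ i ∈ Finset.Icc 1 d,
      IsLeast (succMinRadii (convexBody h) (S : Set (Fin d → Kinf F)) i)
        (succMin (convexBody h) (S : Set (Fin d → Kinf F)) i)) ∧
    succMin (convexBody h) (S : Set (Fin d → Kinf F)) 1 ^ d ≤
      latticeDet g / ((Fintype.card F : ℝ) ^ N * (haar F d (convexBody h)).toReal) ∧
    ∏ i ∈ Finset.Icc 1 d, succMin (convexBody h) (S : Set (Fin d → Kinf F)) i ≤
      latticeDet g / ((Fintype.card F : ℝ) ^ N * (haar F d (convexBody h)).toReal) := by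
  have hmin : ∀ i ∈ Finset.Icc 1 d, ∃ n : ℤ, ballRank h (S : Set (Fin d → Kinf F)) (n - 1) < i ∧
      IsLeast (succMinRadii (convexBody h) (S : Set (Fin d → Kinf F)) i)
        ((Fintype.card F : ℝ) ^ n) := by
    intro i hi
    obtain ⟨hi₁, hi₂⟩ := Finset.mem_Icc.mp hi
    obtain ⟨a, ha⟩ := hS.exists_ballRank_eq_zero h
    obtain ⟨b, hb⟩ := hS.exists_ballRank_eq h
    exact exists_isLeast_succMinRadii h _ i ⟨b, hi₂.trans hb.ge⟩ ⟨a, ha.trans_lt hi₁⟩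
  have hleast : ∀ i ∈ Finset.Icc 1 d,
      IsLeast (succMinRadii (convexBody h) (S : Set (Fin d → Kinf F)) i)
        (succMin (convexBody h) (S : Set (Fin d → Kinf F)) i) := by
    intro i hi
    obtain ⟨n, -, hn⟩ := hmin i hi
    rw [succMin, hn.csInf_eq]
    exact hn
  have hprod : ∏ i ∈ Finset.Icc 1 d, succMin (convexBody h) (S : Set (Fin d → Kinf F)) i ≤
      latticeDet g / ((Fintype.card F : ℝ) ^ N * (haar F d (convexBody h)).toReal) := by
    have hmem : ∀ j : Fin d, (j : ℕ) + 1 ∈ Finset.Icc 1 d := fun j =>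
      Finset.mem_Icc.mpr ⟨Nat.le_add_left _ _, j.2⟩
    choose n hn₁ hn₂ using fun j : Fin d => hmin _ (hmem j)
    have hpos : 0 < (haar F d (convexBody h)).toReal := by
      rw [toReal_haar_convexBody]
      exact absInf_pos (Matrix.isUnits_det_units h).ne_zero
    rw [le_div_iff₀ (mul_pos (pow_pos card_real_pos N) hpos)]
    refine le_of_eq_of_le ?_ (hS.prod_zpow_mul_le h n hn₁)
    congr 1
    calc ∏ i ∈ Finset.Icc 1 d, succMin (convexBody h) (S : Set (Fin d → Kinf F)) i
        = ∏ i ∈ Finset.range d, succMin (convexBody h) (S : Set (Fin d → Kinf F)) (i + 1) := by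
          rw [Finset.range_eq_Ico,
            Finset.prod_Ico_add' (succMin (convexBody h) (S : Set (Fin d → Kinf F)))]
          rfl
      _ = ∏ j : Fin d, succMin (convexBody h) (S : Set (Fin d → Kinf F)) (j + 1) :=
          Finset.prod_range _
      _ = ∏ j, (Fintype.card F : ℝ) ^ n j :=
          Finset.prod_congr rfl fun j _ => (hn₂ j).csInf_eq
  refine ⟨hleast, le_trans ?_ hprod, hprod⟩
  have h₁ : (1 : ℕ) ∈ Finset.Icc 1 d := Finset.mem_Icc.mpr ⟨le_rfl, by omega⟩
  calc succMin (convexBody h) (S : Set (Fin d → Kinf F)) 1 ^ d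
      = ∏ _i ∈ Finset.Icc 1 d, succMin (convexBody h) (S : Set (Fin d → Kinf F)) 1 := by
        rw [Finset.prod_const, Nat.card_Icc, Nat.add_sub_cancel]
    _ ≤ _ := by
        refine Finset.prod_le_prod (fun i _ => (hleast 1 h₁).1.1.le) fun i hi => ?_
        -- A radius admissible for `i` is admissible for 1, hence λ_1 ≤ λ_i.
        exact (hleast 1 h₁).2 ⟨(hleast i hi).1.1, (Finset.mem_Icc.mp hi).1.trans (hleast i hi).1.2⟩
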